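/- **Setting.** Let $N\ge 2$ and let $\mathcal N=\{1,\dots,N\}$ be the set of agents. Agent $i$ has actions $x_i\in\mathbb R^{n_i}$ and cost $J_i:\mathbb R^n\to\mathbb R$, $n=\sum_i n_i$. For every $i$ and every fixed $x_{-i}$, the map $x_i\mapsto J_i(x_i,x_{-i})$ is $C^1$, convex and radially unbounded. The pseudo-gradient $F(x)=\mathrm{col}(\partial J_i(x)/\partial x_i)_{i\in\mathcal N}$ is $\mu$-strongly monotone ($\mu>0$) and $L$-Lipschitz in the Euclidean norm. A Nash equilibrium is a profile $x^*$ such that, for every $i$, $x_i^*$ minimizes $J_i(\cdot,x_{-i}^*)$ over $\mathbb R^{n_i}$. Let $\mathcal G_c$ (communication) and $\mathcal G_o$ (observation) be directed graphs on $\mathcal N$, where every agent observes itself in $\mathcal G_o$. An edge from $j$ to $i$ makes $j$ an in-neighbour of $i$ and $i$ an out-neighbour of $j$. Let $\mathcal N=\mathcal T\sqcup\mathcal A$ (truthful and adversarial agents), and let $D\ge 0$ be an integer. Assume: * every $i\in\mathcal T$ has at most $D$ in-neighbours in $\mathcal A$ and at least $2D+1$ in-neighbours, all with respect to $\mathcal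 G_c$; * every node $m$ is $(2D+1)$-information robust: for each proper subset $S\subsetneq\mathcal N$ that contains all out-neighbours of $m$ in $\mathcal G_o$, there is $j\notin S$ with at least $2D+1$ in-neighbours in $\mathcal G_c$ that lie in $S$. **Algorithm 1** with step size $\alpha$ and weight bound $\eta\in(0,1]$. At iteration $k$ agent $i$ holds an estimate $\mathbf x^i[k]\in\mathbb R^n$ of the whole profile (its $i$-th block is its own action), and $j$ sends $i$ a message $\mathbf y^{ij}[k]\in\mathbb R^n$. Truthful agents $j$ send $\mathbf y^{ij}[k]=\mathbf x^j[k]$, messages of adversarial agents are arbitrary, and $\mathbf y^{ii}[k]=\mathbf x^i[k]$. For every scalar component $(m,q)$, an intermediate estimate $\mathbf v^i_{mq}[k]$ is formed: * if $i$ observes $m$ in $\mathcal G_o$, then $\mathbf v^i_{mq}[k]=\mathbf x^m_{mq}[k]$, the true action component; * if $i\in\mathcal T$ does not observe $m$, then among the messages $\mathbf y^{ij}_{mq}[k]$ from its in-neighbours $j$ in $\mathcal G_c$ it removes the $D$ largest of those larger than $\mathbf x^i_{mq}[k]$ and the $D$ smallest of those smaller than $\mathbf x^i_{mq}[k]$ (all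 of them if there are fewer than $D$; ties broken arbitrarily). It sets $\mathbf v^i_{mq}[k]=\sum_{j\in\mathcal Y}w_j\mathbf y^{ij}_{mq}[k]$, where $\mathcal Y$ consists of the retained senders and $i$ itself, $\sum_{j\in\mathcal Y}w_j=1$ and every $w_j\ge\eta$. The weights may depend on $i,m,q,k$; * if $i\in\mathcal A$ does not observe $m$, then $\mathbf v^i_{mq}[k]$ is some convex combination of the messages $\mathbf y^{ij}_{mq}[k]$ of its truthful in-neighbours $j$ in $\mathcal G_c$ and of its own estimate $\mathbf x^i_{mq}[k]$, in which the truthful messages have total weight at least $\eta$. Then every agent sets $\mathbf x^i[k+1]=\mathbf v^i[k]-\alpha\,\mathcal R_i^T\,\partial J_i(\mathbf v^i[k])/\partial x_i$, where $\mathcal R_i^T$ embeds $\mathbb R^{n_i}$ into $\mathbb R^n$ as the $i$-th block. The initial $\mathbf x[0]$ and $\mathbf v[0]$ are arbitrary ($\mathbf v[0]$ may, but need not, be formed from $\mathbf x[0]$ as above), and the rules for $\mathbf v[k]$ are imposed for $k\ge1$. **Theorem.** Let $C=1-(\eta/2)^{N-1}$, $\ \overline p=\dfrac{4N}{1-C^{2/(N-1)}}$,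 and $$M=\begin{bmatrix}2\alpha\mu-\overline p\alpha^2L^2&-\alpha\overline pL(1+\alpha L)\\-\alpha\overline pL(1+\alpha L)&1-2\alpha(\overline p-1)L-\overline p\alpha^2L^2\end{bmatrix}.$$ If $M$ is positive definite, then the game has exactly one Nash equilibrium $x^*$, and every execution of Algorithm 1, from any initial condition, satisfies $\mathbf x^i[k]\to x^*$ for all $i\in\mathcal N$ as $k\to\infty$, i.e. $\mathrm{col}(\mathbf x^i[k])_{i\in\mathcal N}\to\mathbf 1\otimes x^*$. -/

import Mathlib

namespace RobustNE

noncomputable section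

/-! ### Games -/

/-- Action space `ℝ^{n_i}` of player `i`, with its Euclidean norm. -/
abbrev Action {N : ℕ} (d : Fin N → ℕ) (i : Fin N) : Type :=
  EuclideanSpace ℝ (Fin (d i))

/-- Action profiles: `ℝ^n` with `n = ∑ n_i`; the coordinate `⟨m, q⟩` is the `q`-th component of
the action of player `m`. Euclidean norm. -/
abbrev Profile {N : ℕ} (d : Fin N → ℕ) : Type :=
  EuclideanSpace ℝ ((m : Fin N) × Fin (d m))

/-- The block `x_i` of a profile. -/
def block {N : ℕ} {d : Fin N → ℕ} (x : Profile d) (i : Fin N) : Action d i :=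
  WithLp.toLp 2 (fun q => x ⟨i, q⟩)

/-- The profile `(t, x_{-i})`: the block of player `i` is replaced by `t`. -/
def setBlock {N : ℕ} {d : Fin N → ℕ} (x : Profile d) (i : Fin N) (t : Action d i) : Profile d :=
  WithLp.toLp 2 (fun p => if h : p.1 = i then t (Fin.cast (congrArg d h) p.2) else x p)

/-- The partial gradient `∂J_i/∂x_i` at `x`. -/
def partialGrad {N : ℕ} {d : Fin N → ℕ} (J : Fin N → Profile d → ℝ) (i : Fin N)
    (x : Profile d) : Action d i :=
  gradient (fun t : Action d i => J i (setBlock x i t)) (block x i)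

/-- The pseudo-gradient `F(x) = col (∂J_i(x)/∂x_i)_i`. -/
def pseudoGrad {N : ℕ} {d : Fin N → ℕ} (J : Fin N → Profile d → ℝ) (x : Profile d) :
    Profile d :=
  WithLp.toLp 2 (fun p => partialGrad J p.1 x p.2)

/-- Nash equilibrium of the unconstrained game. -/
def IsNash {N : ℕ} {d : Fin N → ℕ} (J : Fin N → Profile d → ℝ) (x : Profile d) : Prop :=
  ∀ (i : Fin N) (t : Action d i), J i x ≤ J i (setBlock x i t)

/-- Standing assumption on the game: for every fixed `x_{-i}` the cost `J_i(·, x_{-i})` is `C^1`,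
convex and radially unbounded, and the pseudo-gradient is `μ`-strongly monotone and
`L`-Lipschitz. -/
structure RegularGame {N : ℕ} {d : Fin N → ℕ} (J : Fin N → Profile d → ℝ) (μ : ℝ)
    (L : NNReal) : Prop where
  contDiff : ∀ (i : Fin N) (x : Profile d),
    ContDiff ℝ 1 (fun t : Action d i => J i (setBlock x i t))
  convex : ∀ (i : Fin N) (x : Profile d),
    ConvexOn ℝ Set.univ (fun t : Action d i => J i (setBlock x i t))
  radiallyUnbounded : ∀ (i : Fin N) (x : Profile d),
    Filter.Tendsto (fun t : Action d i => J i (setBlock x i t))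
      (Filter.cocompact (Action d i)) Filter.atTop
  mu_pos : 0 < μ
  stronglyMonotone : ∀ x y : Profile d,
    μ * ‖x - y‖ ^ 2 ≤ inner ℝ (x - y) (pseudoGrad J x - pseudoGrad J y)
  lipschitz : LipschitzWith L (pseudoGrad J)

/-! ### Graphs. `G.Adj j i` is the edge from `j` to `i` (information flows from `j` to `i`). -/

open Classical in
/-- In-neighbours of `i`. -/
def inNbrs {N : ℕ} (G : Digraph (Fin N)) (i : Fin N) : Finset (Fin N) :=
  Finset.univ.filter (fun j => G.Adj j i)

open Classical in
/-- Out-neighbours of `i`. -/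
def outNbrs {N : ℕ} (G : Digraph (Fin N)) (i : Fin N) : Finset (Fin N) :=
  Finset.univ.filter (fun j => G.Adj i j)

/-- `S` is `r`-local in `G`: every node outside `S` has at most `r` in-neighbours in `S`. -/
def IsLocalSet {N : ℕ} (G : Digraph (Fin N)) (r : ℕ) (S : Finset (Fin N)) : Prop :=
  ∀ i ∉ S, (inNbrs G i ∩ S).card ≤ r

/-- Node `i` is `r`-information robust: every proper set `S` of nodes that contains all nodes
observing `i` leaves out a node with at least `r` communication in-neighbours in `S`. -/
def InfoRobust {N : ℕ} (Gc Go : Digraph (Fin N)) (r : ℕ) (i : Fin N) : Prop :=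
  ∀ S : Finset (Fin N), outNbrs Go i ⊆ S → S ≠ Finset.univ →
    ∃ j ∉ S, r ≤ (inNbrs Gc j ∩ S).card

/-! ### The algorithm -/

/-- `R` consists of the `D` largest values (of all, if there are fewer than `D`) among the
senders in `nbrs` whose value `val j` exceeds `own`; ties are broken arbitrarily. -/
def RemovesHighest {N : ℕ} (D : ℕ) (nbrs : Finset (Fin N)) (own : ℝ) (val : Fin N → ℝ)
    (R : Finset (Fin N)) : Prop :=
  R ⊆ nbrs ∧ (∀ j ∈ R, own < val j) ∧
    R.card = min D (nbrs.filter (fun j => own < val j)).card ∧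
    ∀ a ∈ R, ∀ b ∈ nbrs, b ∉ R → val b ≤ val a

/-- `R` consists of the `D` smallest values (of all, if there are fewer than `D`) among the
senders in `nbrs` whose value `val j` is below `own`; ties are broken arbitrarily. -/
def RemovesLowest {N : ℕ} (D : ℕ) (nbrs : Finset (Fin N)) (own : ℝ) (val : Fin N → ℝ)
    (R : Finset (Fin N)) : Prop :=
  R ⊆ nbrs ∧ (∀ j ∈ R, val j < own) ∧
    R.card = min D (nbrs.filter (fun j => val j < own)).card ∧
    ∀ a ∈ R, ∀ b ∈ nbrs, b ∉ R → val a ≤ val b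

/-- `Y` is a possible outcome of the trimming done by agent `i`: the agents whose message is
retained, together with `i` itself. -/
def IsRetained {N : ℕ} (D : ℕ) (nbrs : Finset (Fin N)) (i : Fin N) (own : ℝ) (val : Fin N → ℝ)
    (Y : Finset (Fin N)) : Prop :=
  ∃ RH RL : Finset (Fin N), RemovesHighest D nbrs own val RH ∧ RemovesLowest D nbrs own val RL ∧
    Y = insert i (nbrs \ (RH ∪ RL))

/-- Value that a truthful agent `i` may compute from the messages `val j` about one scalar
component that it does not observe: trim, then average the retained messages with weights that
sum to one and are at least `η`. -/
def TruthfulAverage {N : ℕ} (Gc : Digraph (Fin N)) (D : ℕ) (η : ℝ) (i : Fin N) (own : ℝ)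
    (val : Fin N → ℝ) (out : ℝ) : Prop :=
  ∃ (Y : Finset (Fin N)) (w : Fin N → ℝ), IsRetained D (inNbrs Gc i) i own val Y ∧
    (∀ j ∈ Y, η ≤ w j) ∧ ∑ j ∈ Y, w j = 1 ∧ out = ∑ j ∈ Y, w j * val j

/-- Value that an adversarial agent `i ∈ A` may compute from the messages `val j` about one scalar
component that it does not observe: a weighted average of the messages of its truthful
in-neighbours, in which its own estimate `val i` may also take part as long as the truthful
messages keep total weight at least `η`. -/
def AdversaryAverage {N : ℕ} (Gc : Digraph (Fin N)) (A : Finset (Fin N)) (η : ℝ) (i : Fin N)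
    (val : Fin N → ℝ) (out : ℝ) : Prop :=
  ∃ w : Fin N → ℝ, (∀ j, 0 ≤ w j) ∧ (∀ j, j ∉ inNbrs Gc i \ A → j ≠ i → w j = 0) ∧
    ∑ j, w j = 1 ∧ η ≤ ∑ j ∈ inNbrs Gc i \ A, w j ∧ out = ∑ j, w j * val j

/-- `x`, `v`, `y` form an execution of the algorithm with adversary set `A`.
`x k i` is the estimate of the whole profile held by agent `i` at iteration `k` (its `i`-th block
is the action that `i` plays), `v k i` the intermediate estimate, and `y k i j` the message that
agent `j` sends to agent `i`. Nothing is required of the messages sent by adversaries. The pair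
`x 0`, `v 0` is an arbitrary initial condition; in particular `v 0` may, but need not, be computed
from `x 0` by the averaging step. -/
structure IsExecution {N : ℕ} {d : Fin N → ℕ} (J : Fin N → Profile d → ℝ)
    (Gc Go : Digraph (Fin N)) (A : Finset (Fin N)) (D : ℕ) (η α : ℝ)
    (x v : ℕ → Fin N → Profile d) (y : ℕ → Fin N → Fin N → Profile d) : Prop where
  self_message : ∀ k i, y k i i = x k i
  truthful_message : ∀ k, ∀ j ∉ A, ∀ i, Gc.Adj j i → y k i j = x k j
  observed : ∀ k, k ≠ 0 → ∀ (i m : Fin N) (q : Fin (d m)), Go.Adj m i →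
    v k i ⟨m, q⟩ = x k m ⟨m, q⟩
  truthful_average : ∀ k, k ≠ 0 → ∀ i ∉ A, ∀ (m : Fin N) (q : Fin (d m)), ¬ Go.Adj m i →
    TruthfulAverage Gc D η i (x k i ⟨m, q⟩) (fun j => y k i j ⟨m, q⟩) (v k i ⟨m, q⟩)
  adversary_average : ∀ k, k ≠ 0 → ∀ i ∈ A, ∀ (m : Fin N) (q : Fin (d m)), ¬ Go.Adj m i →
    AdversaryAverage Gc A η i (fun j => y k i j ⟨m, q⟩) (v k i ⟨m, q⟩)
  gradient_step : ∀ k i,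
    x (k + 1) i = v k i - α • setBlock 0 i (partialGrad J i (v k i))

/-! ### The step-size condition -/

/-- `C = 1 - (η/2)^{N-1}`. -/
def contractionC (N : ℕ) (η : ℝ) : ℝ := 1 - (η / 2) ^ (N - 1)

/-- `p̄ = 4N / (1 - C^{2/(N-1)})`, meaningful for `N ≥ 2`. -/
def pBar (N : ℕ) (η : ℝ) : ℝ :=
  4 * (N : ℝ) / (1 - Real.rpow (contractionC N η) (2 / ((N : ℝ) - 1)))

/-- The matrix `M` built from `μ`, `L`, `p̄` and the step size `α`. -/
def matM (μ L p α : ℝ) : Matrix (Fin 2) (Fin 2) ℝ :=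
  !![2 * α * μ - p * α ^ 2 * L ^ 2, -(α * p * L * (1 + α * L));
     -(α * p * L * (1 + α * L)), 1 - 2 * α * (p - 1) * L - p * α ^ 2 * L ^ 2]

end

end RobustNE

/-!
Under monotonicity the Nash equilibria are the zeros of the pseudo-gradient `F`, and a strongly
monotone Lipschitz operator has exactly one zero `x*`.

After trimming, whatever a truthful agent retains lies between values held by truthful agents. An
intermediate estimate is therefore a convex combination of truthful values, and information
robustness arranges the agents in `N - 1` levels such that weight at least `η` falls on the exact
value or on lower levels. Hence the estimation errors follow a linear recursion with substochastic
matrices, whose unforced solutions shrink by the factor `C` every `N - 1` steps, driven by the moves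
`α g[k]` of the agents. Let `E[k]` be the energy of the errors `e[k]`, that is, the sum of the
squared norms of the unforced trajectory that starts in them. Then `‖X[k] - x*‖ ^ 2 + E[k]`, where
`X[k]` is the profile that is played, decreases in each step by at least the quadratic form of `M`
at `(‖X[k] - x*‖, ‖e[k]‖)`.
-/

namespace RobustNE

/-! ### Strongly monotone operators -/

lemma contractingWith_sqrt {X : Type*} [MetricSpace X] {f : X → X} {q : ℝ} (hq : q < 1)
    (hf : ∀ x y, dist (f x) (f y) ^ 2 ≤ q * dist x y ^ 2) : ContractingWith (√q).toNNReal f := by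
  refine ⟨?_, LipschitzWith.of_dist_le_mul fun x y => ?_⟩
  · rwa [Real.toNNReal_lt_one, Real.sqrt_lt' one_pos, one_pow]
  · rw [Real.coe_toNNReal _ (Real.sqrt_nonneg q)]
    have h := Real.sqrt_le_sqrt (hf x y)
    rwa [Real.sqrt_mul' _ (sq_nonneg _), Real.sqrt_sq dist_nonneg, Real.sqrt_sq dist_nonneg] at h

section StronglyMonotone

variable {H : Type*} [NormedAddCommGroup H] [InnerProductSpace ℝ H] {F : H → H} {μ : ℝ} {L : NNReal}

/-- The operator `F` is `μ`-strongly monotone. The constant `μ` is not required to be positive, so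
that `StronglyMonotone 0 F` says that `F` is monotone. -/
def StronglyMonotone (μ : ℝ) (F : H → H) : Prop :=
  ∀ x y, μ * ‖x - y‖ ^ 2 ≤ inner ℝ (x - y) (F x - F y)

lemma StronglyMonotone.inner_nonneg (hF : StronglyMonotone μ F) (hμ : 0 ≤ μ) (x y : H) :
    0 ≤ inner ℝ (x - y) (F x - F y) :=
  (mul_nonneg hμ (sq_nonneg _)).trans (hF x y)

lemma StronglyMonotone.injective (hF : StronglyMonotone μ F) (hμ : 0 < μ) :
    Function.Injective F := by
  intro x y hxy
  have h : μ * ‖x - y‖ ^ 2 ≤ 0 := by simpa only [hxy, sub_self, inner_zero_right] using hF x y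
  have hnorm : ‖x - y‖ ^ 2 = 0 := le_antisymm (nonpos_of_mul_nonpos_right h hμ) (sq_nonneg _)
  exact sub_eq_zero.1 (norm_eq_zero.1 (pow_eq_zero_iff two_ne_zero |>.1 hnorm))

lemma StronglyMonotone.norm_sub_smul_sq_le (hF : StronglyMonotone μ F) (hL : LipschitzWith L F)
    {α : ℝ} (hα : 0 ≤ α) (x y : H) :
    ‖(x - y) - α • (F x - F y)‖ ^ 2 ≤ (1 - 2 * α * μ + α ^ 2 * (L : ℝ) ^ 2) * ‖x - y‖ ^ 2 := by
  have hLip : ‖F x - F y‖ ^ 2 ≤ (L * ‖x - y‖) ^ 2 := by gcongr; exact hL.norm_sub_le x y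
  calc ‖(x - y) - α • (F x - F y)‖ ^ 2
      = ‖x - y‖ ^ 2 - 2 * α * inner ℝ (x - y) (F x - F y) + α ^ 2 * ‖F x - F y‖ ^ 2 := by
        rw [norm_sub_sq_real, real_inner_smul_right, norm_smul, Real.norm_eq_abs, mul_pow, sq_abs]
        ring
    _ ≤ ‖x - y‖ ^ 2 - 2 * α * (μ * ‖x - y‖ ^ 2) + α ^ 2 * (L * ‖x - y‖) ^ 2 := by
        gcongr; exact hF x y
    _ = (1 - 2 * α * μ + α ^ 2 * (L : ℝ) ^ 2) * ‖x - y‖ ^ 2 := by ring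

lemma StronglyMonotone.surjective [CompleteSpace H] (hF : StronglyMonotone μ F) (hμ : 0 < μ)
    (hL : LipschitzWith L F) : Function.Surjective F := by
  intro b
  set α : ℝ := μ / ((L : ℝ) ^ 2 + 1)
  have hα0 : 0 < α := by positivity
  have hαL : α * ((L : ℝ) ^ 2 + 1) = μ := div_mul_cancel₀ _ (by positivity)
  have hq : 1 - 2 * α * μ + α ^ 2 * (L : ℝ) ^ 2 < 1 := by
    have : 0 < α * (μ + α) := by positivity
    linear_combination this + α * hαL
  have hcontr := contractingWith_sqrt (f := fun x => x - α • (F x - b)) hq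
    fun x y => by
      have hsub : x - α • (F x - b) - (y - α • (F y - b)) = x - y - α • (F x - F y) := by module
      rw [dist_eq_norm, dist_eq_norm, hsub]
      exact hF.norm_sub_smul_sq_le hL hα0.le x y
  have hfix : hcontr.fixedPoint - α • (F hcontr.fixedPoint - b) = hcontr.fixedPoint :=
    hcontr.fixedPoint_isFixedPt
  exact ⟨hcontr.fixedPoint,
    sub_eq_zero.1 ((smul_eq_zero.1 (sub_eq_self.1 hfix)).resolve_left hα0.ne')⟩

lemma StronglyMonotone.existsUnique_eq_zero [CompleteSpace H] (hF : StronglyMonotone μ F)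
    (hμ : 0 < μ) (hL : LipschitzWith L F) : ∃! x, F x = 0 :=
  Function.Bijective.existsUnique ⟨hF.injective hμ, hF.surjective hμ hL⟩ 0

lemma StronglyMonotone.norm_sub_smul_sub_sq_le (hF : StronglyMonotone μ F) {x x₀ g : H} {α δ : ℝ}
    (hα : 0 ≤ α) (hx₀ : F x₀ = 0) (hg : ‖g - F x‖ ≤ δ) :
    ‖x - α • g - x₀‖ ^ 2 ≤
      (1 - 2 * α * μ) * ‖x - x₀‖ ^ 2 + 2 * α * (‖x - x₀‖ * δ) + α ^ 2 * ‖g‖ ^ 2 := by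
  have hinner : μ * ‖x - x₀‖ ^ 2 - ‖x - x₀‖ * δ ≤ inner ℝ (x - x₀) g := by
    have hmono := hF x x₀
    have hcs : -(‖x - x₀‖ * ‖g - F x‖) ≤ inner ℝ (x - x₀) (g - F x) :=
      neg_le_of_abs_le (abs_real_inner_le_norm _ _)
    have hδ : ‖x - x₀‖ * ‖g - F x‖ ≤ ‖x - x₀‖ * δ := by gcongr
    rw [hx₀, sub_zero] at hmono
    rw [inner_sub_right] at hcs
    linarith
  calc ‖x - α • g - x₀‖ ^ 2
      = ‖x - x₀‖ ^ 2 - 2 * α * inner ℝ (x - x₀) g + α ^ 2 * ‖g‖ ^ 2 := by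
        rw [sub_right_comm, norm_sub_sq_real, real_inner_smul_right, norm_smul, Real.norm_eq_abs,
          mul_pow, sq_abs]
        ring
    _ ≤ ‖x - x₀‖ ^ 2 - 2 * α * (μ * ‖x - x₀‖ ^ 2 - ‖x - x₀‖ * δ) + α ^ 2 * ‖g‖ ^ 2 := by gcongr
    _ = _ := by ring

end StronglyMonotone

/-! ### Nash equilibria are the zeros of the pseudo-gradient -/

lemma le_of_inner_gradient_nonneg {H : Type*} [NormedAddCommGroup H] [InnerProductSpace ℝ H]
    [CompleteSpace H] {f : H → ℝ} (hf : Differentiable ℝ f) {x : H}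
    (h : ∀ y, 0 ≤ inner ℝ (gradient f y) (y - x)) (y : H) : f x ≤ f y := by
  set p : ℝ →ᵃ[ℝ] H := AffineMap.lineMap x y with hp
  have hderiv (s : ℝ) : HasDerivAt (f ∘ p) (inner ℝ (gradient f (p s)) (y - x)) s := by
    simpa using (hf (p s)).hasGradientAt.hasFDerivAt.comp_hasDerivAt s AffineMap.hasDerivAt_lineMap
  have hmono : MonotoneOn (f ∘ p) (Set.Ici 0) := by
    refine monotoneOn_of_hasDerivWithinAt_nonneg (convex_Ici 0)
      (fun s _ => (hderiv s).continuousAt.continuousWithinAt)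
      (fun s _ => (hderiv s).hasDerivWithinAt) fun s hs => ?_
    rw [interior_Ici, Set.mem_Ioi] at hs
    have hps : p s - x = s • (y - x) := by simp [hp, AffineMap.lineMap_apply]
    have hs' := h (p s)
    rw [hps, real_inner_smul_right] at hs'
    exact nonneg_of_mul_nonneg_right hs' hs
  simpa [hp] using hmono Set.self_mem_Ici (Set.mem_Ici.2 zero_le_one) zero_le_one

section Game

variable {N : ℕ} {d : Fin N → ℕ} {J : Fin N → Profile d → ℝ}

lemma setBlock_apply_self (x : Profile d) (i : Fin N) (t : Action d i) (q : Fin (d i)) :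
    setBlock x i t ⟨i, q⟩ = t q := by
  simp [setBlock]

lemma setBlock_apply_of_ne (x : Profile d) {i : Fin N} (t : Action d i)
    {p : (m : Fin N) × Fin (d m)} (h : p.1 ≠ i) : setBlock x i t p = x p := by
  simp [setBlock, h]

lemma block_setBlock (x : Profile d) (i : Fin N) (t : Action d i) :
    block (setBlock x i t) i = t := by
  ext q
  exact setBlock_apply_self x i t q

lemma setBlock_setBlock (x : Profile d) (i : Fin N) (s t : Action d i) :
    setBlock (setBlock x i s) i t = setBlock x i t := by
  ext p
  by_cases h : p.1 = i <;> simp [setBlock, h]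

lemma setBlock_block (x : Profile d) (i : Fin N) : setBlock x i (block x i) = x := by
  ext ⟨m, q⟩
  by_cases h : m = i
  · subst h
    exact setBlock_apply_self ..
  · exact setBlock_apply_of_ne x _ h

lemma partialGrad_setBlock (i : Fin N) (x : Profile d) (t : Action d i) :
    partialGrad J i (setBlock x i t) = gradient (fun s => J i (setBlock x i s)) t := by
  simp only [partialGrad, block_setBlock, setBlock_setBlock]

lemma pseudoGrad_eq_zero_iff {x : Profile d} : pseudoGrad J x = 0 ↔ ∀ i, partialGrad J i x = 0 := by
  constructor
  · intro h i
    ext q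
    exact congrArg (fun z : Profile d => z ⟨i, q⟩) h
  · intro h
    ext ⟨i, q⟩
    exact congrArg (fun z : Action d i => z q) (h i)

lemma inner_setBlock_sub (x z : Profile d) (i : Fin N) (t : Action d i) :
    inner ℝ (setBlock x i t - x) z = inner ℝ (block z i) (t - block x i) := by
  have hother : ∀ m ≠ i, ∑ q, z ⟨m, q⟩ * (setBlock x i t - x) ⟨m, q⟩ = 0 := fun m hm =>
    Finset.sum_eq_zero fun q _ => by simp [setBlock_apply_of_ne x t (p := ⟨m, q⟩) hm]
  simp only [PiLp.inner_apply, Fintype.sum_sigma, RCLike.inner_apply, conj_trivial]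
  rw [Fintype.sum_eq_single i hother]
  simp only [PiLp.sub_apply, setBlock_apply_self, block, mul_comm]

lemma isNash_iff_pseudoGrad_eq_zero
    (hdiff : ∀ i x, Differentiable ℝ fun t : Action d i => J i (setBlock x i t))
    (hmono : ∀ x y, 0 ≤ inner ℝ (x - y) (pseudoGrad J x - pseudoGrad J y)) {x : Profile d} :
    IsNash J x ↔ pseudoGrad J x = 0 := by
  constructor
  · refine fun h => pseudoGrad_eq_zero_iff.2 fun i => ?_
    have hmin : IsLocalMin (fun t => J i (setBlock x i t)) (block x i) :=
      Filter.Eventually.of_forall fun t => by simpa only [setBlock_block] using h i t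
    rw [partialGrad, gradient, hmin.fderiv_eq_zero, map_zero]
  · intro h i t
    have hray (s : Action d i) :
        0 ≤ inner ℝ (gradient (fun t => J i (setBlock x i t)) s) (s - block x i) := by
      have hs := hmono (setBlock x i s) x
      rwa [h, sub_zero, inner_setBlock_sub,
        show block (pseudoGrad J _) i = partialGrad J i _ from rfl, partialGrad_setBlock] at hs
    simpa only [setBlock_block] using le_of_inner_gradient_nonneg (hdiff i x) hray t

end Game

/-! ### Trimmed averages as averages of truthful values -/

section WeightedMean

variable {ι : Type*} [Fintype ι] {T S : Finset ι} {θ x y : ℝ} {f g : ι → ℝ}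

/-- `x` is a weighted mean of the values `f l`, `l ∈ T`, in which the indices from `S` have total
weight at least `θ`. -/
def IsWeightedMean (T S : Finset ι) (θ : ℝ) (f : ι → ℝ) (x : ℝ) : Prop :=
  ∃ a ∈ stdSimplex ℝ ι, (∀ l ∉ T, a l = 0) ∧ θ ≤ ∑ l ∈ S, a l ∧ x = ∑ l, a l * f l

lemma isWeightedMean_zero_of_mem {l : ι} (hT : l ∈ T) :
    IsWeightedMean T S 0 f (f l) := by
  classical
  refine ⟨Pi.single l 1, single_mem_stdSimplex ℝ l, fun j hj => ?_,
    Finset.sum_nonneg fun j _ => (single_mem_stdSimplex ℝ l).1 j, by simp [Pi.single_apply]⟩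
  exact Pi.single_eq_of_ne (by rintro rfl; exact hj hT) 1

lemma isWeightedMean_one_of_mem {l : ι} (hT : l ∈ T) (hS : l ∈ S) :
    IsWeightedMean T S 1 f (f l) := by
  classical
  refine ⟨Pi.single l 1, single_mem_stdSimplex ℝ l, fun j hj => ?_, by simp [hS],
    by simp [Pi.single_apply]⟩
  exact Pi.single_eq_of_ne (by rintro rfl; exact hj hT) 1

lemma IsWeightedMean.congr (h : IsWeightedMean T S θ f x) (hfg : ∀ l ∈ T, f l = g l) :
    IsWeightedMean T S θ g x := by
  obtain ⟨a, ha, haT, hθ, rfl⟩ := h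
  refine ⟨a, ha, haT, hθ, Finset.sum_congr rfl fun l _ => ?_⟩
  by_cases hl : l ∈ T
  · rw [hfg l hl]
  · rw [haT l hl, zero_mul, zero_mul]

lemma IsWeightedMean.mono {θ' : ℝ} (h : IsWeightedMean T S θ f x) (hθ : θ' ≤ θ) :
    IsWeightedMean T S θ' f x :=
  let ⟨a, ha, haT, hS, hx⟩ := h
  ⟨a, ha, haT, hθ.trans hS, hx⟩

lemma convex_isWeightedMean (T S : Finset ι) (f : ι → ℝ) :
    Convex ℝ {p : ℝ × ℝ | IsWeightedMean T S p.1 f p.2} := by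
  rintro p ⟨a, ha, haT, haS, hap⟩ q ⟨b, hb, hbT, hbS, hbq⟩ s t hs ht hst
  refine ⟨s • a + t • b, convex_stdSimplex ℝ ι ha hb hs ht hst, fun l hl => ?_, ?_, ?_⟩
  · simp [haT l hl, hbT l hl]
  · simp only [Prod.fst_add, Prod.smul_fst, Pi.add_apply, Pi.smul_apply, smul_eq_mul,
      Finset.sum_add_distrib, ← Finset.mul_sum]
    gcongr
  · simp only [Prod.snd_add, Prod.smul_snd, Pi.add_apply, Pi.smul_apply, smul_eq_mul, hap, hbq,
      add_mul, Finset.sum_add_distrib, Finset.mul_sum, mul_assoc]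

lemma IsWeightedMean.of_mem_Icc {z : ℝ} (hx : IsWeightedMean T S θ f x)
    (hy : IsWeightedMean T S θ f y) (hz : z ∈ Set.Icc x y) : IsWeightedMean T S θ f z := by
  rw [← segment_eq_Icc (hz.1.trans hz.2)] at hz
  obtain ⟨s, t, hs, ht, hst, rfl⟩ := hz
  have h := convex_isWeightedMean T S f (x := (θ, x)) hx (y := (θ, y)) hy hs ht hst
  simpa only [Set.mem_ofPred_eq, Prod.fst_add, Prod.snd_add, Prod.smul_fst, Prod.smul_snd,
    ← add_smul, hst, one_smul] using h

lemma IsWeightedMean.sum {κ : Type*} {Y : Finset κ} {w ϑ z : κ → ℝ} (hw : ∀ j ∈ Y, 0 ≤ w j)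
    (hw1 : ∑ j ∈ Y, w j = 1) (h : ∀ j ∈ Y, IsWeightedMean T S (ϑ j) f (z j)) :
    IsWeightedMean T S (∑ j ∈ Y, w j * ϑ j) f (∑ j ∈ Y, w j * z j) := by
  simpa only [Set.mem_ofPred_eq, Prod.fst_sum, Prod.snd_sum, Prod.smul_fst, Prod.smul_snd,
    smul_eq_mul] using (convex_isWeightedMean T S f).sum_mem hw hw1 (z := fun j => (ϑ j, z j)) h

end WeightedMean

section Trim

variable {N D : ℕ} {nbrs A S Y R : Finset (Fin N)} {i j : Fin N} {own : ℝ} {val : Fin N → ℝ}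

lemma RemovesHighest.card_le (h : RemovesHighest D nbrs own val R) : R.card ≤ D :=
  h.2.2.1.trans_le (min_le_left _ _)

lemma RemovesLowest.neg (h : RemovesLowest D nbrs own val R) :
    RemovesHighest D nbrs (-own) (fun j => -val j) R := by
  obtain ⟨hsub, hown, hcard, hmin⟩ := h
  refine ⟨hsub, fun j hj => neg_lt_neg (hown j hj), ?_,
    fun a ha b hb hbR => neg_le_neg (hmin a ha b hb hbR)⟩
  simpa only [neg_lt_neg_iff] using hcard

-- The `D` removed senders and the surviving `j ∈ A` cannot all be adversaries.
lemma RemovesHighest.exists_le_of_notMem (h : RemovesHighest D nbrs own val R)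
    (hA : (nbrs ∩ A).card ≤ D) (hj : j ∈ nbrs) (hjA : j ∈ A) (hjR : j ∉ R) (hval : own < val j) :
    ∃ t ∈ nbrs \ A, val j ≤ val t := by
  obtain ⟨hsub, hown, hcard, hmax⟩ := h
  have hR : R ⊂ nbrs.filter (fun j => own < val j) :=
    (Finset.ssubset_iff_of_subset fun a ha => Finset.mem_filter.2 ⟨hsub ha, hown a ha⟩).2
      ⟨j, Finset.mem_filter.2 ⟨hj, hval⟩, hjR⟩
  have hRD : R.card = D := by have := Finset.card_lt_card hR; lia
  have hRA : ¬ R ⊆ A := fun hRA => by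
    have hins : insert j R ⊆ nbrs ∩ A :=
      Finset.insert_subset (Finset.mem_inter.2 ⟨hj, hjA⟩) (Finset.subset_inter hsub hRA)
    have hle := Finset.card_le_card hins
    rw [Finset.card_insert_of_notMem hjR] at hle
    lia
  obtain ⟨t, ht, htA⟩ := Finset.not_subset.1 hRA
  exact ⟨t, Finset.mem_sdiff.2 ⟨hsub ht, htA⟩, hmax t ht j hj hjR⟩

lemma RemovesLowest.exists_ge_of_notMem (h : RemovesLowest D nbrs own val R)
    (hA : (nbrs ∩ A).card ≤ D) (hj : j ∈ nbrs) (hjA : j ∈ A) (hjR : j ∉ R) (hval : val j < own) :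
    ∃ t ∈ nbrs \ A, val t ≤ val j := by
  obtain ⟨t, ht, hle⟩ := h.neg.exists_le_of_notMem hA hj hjA hjR (neg_lt_neg hval)
  exact ⟨t, ht, neg_le_neg_iff.1 hle⟩

lemma IsRetained.isWeightedMean (hY : IsRetained D nbrs i (val i) val Y)
    (hA : (nbrs ∩ A).card ≤ D) (hj : j ∈ Y) :
    IsWeightedMean (insert i (nbrs \ A)) S 0 val (val j) := by
  obtain ⟨RH, RL, hH, hL, rfl⟩ := hY
  have htruthful {l : Fin N} (hl : l ∈ insert i (nbrs \ A)) :
      IsWeightedMean (insert i (nbrs \ A)) S 0 val (val l) := isWeightedMean_zero_of_mem hl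
  have hself := htruthful (Finset.mem_insert_self i _)
  rcases Finset.mem_insert.1 hj with rfl | hj
  · exact hself
  simp only [Finset.mem_sdiff, Finset.mem_union, not_or] at hj
  obtain ⟨hj, hjH, hjL⟩ := hj
  by_cases hjA : j ∈ A
  · rcases lt_trichotomy (val j) (val i) with hlt | heq | hgt
    · obtain ⟨t, ht, hle⟩ := hL.exists_ge_of_notMem hA hj hjA hjL hlt
      exact (htruthful (Finset.mem_insert_of_mem ht)).of_mem_Icc hself ⟨hle, hlt.le⟩
    · rwa [heq]
    · obtain ⟨t, ht, hle⟩ := hH.exists_le_of_notMem hA hj hjA hjH hgt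
      exact hself.of_mem_Icc (htruthful (Finset.mem_insert_of_mem ht)) ⟨hgt.le, hle⟩
  · exact htruthful (Finset.mem_insert_of_mem (Finset.mem_sdiff.2 ⟨hj, hjA⟩))

-- Either a truthful sender in `S` survives, or such senders were removed on both sides of `val i`.
lemma IsRetained.exists_isWeightedMean_one (hY : IsRetained D nbrs i (val i) val Y)
    (hS : D < ((nbrs \ A) ∩ S).card) :
    ∃ j ∈ Y, IsWeightedMean (insert i (nbrs \ A)) S 1 val (val j) := by
  obtain ⟨RH, RL, hH, hL, rfl⟩ := hY
  have htruthful {l : Fin N} (hl : l ∈ (nbrs \ A) ∩ S) :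
      IsWeightedMean (insert i (nbrs \ A)) S 1 val (val l) :=
    isWeightedMean_one_of_mem (Finset.mem_insert_of_mem (Finset.mem_inter.1 hl).1)
      (Finset.mem_inter.1 hl).2
  have hexists {R : Finset (Fin N)} (hR : R.card ≤ D) : ∃ l ∈ (nbrs \ A) ∩ S, l ∉ R :=
    Finset.exists_mem_notMem_of_card_lt_card (hR.trans_lt hS)
  by_cases hex : (nbrs \ A) ∩ S ⊆ RH ∪ RL
  · obtain ⟨h, hhS, hhL⟩ := hexists hL.neg.card_le
    obtain ⟨l, hlS, hlH⟩ := hexists hH.card_le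
    have hh : h ∈ RH := (Finset.mem_union.1 (hex hhS)).resolve_right hhL
    have hl : l ∈ RL := (Finset.mem_union.1 (hex hlS)).resolve_left hlH
    exact ⟨i, Finset.mem_insert_self _ _,
      (htruthful hlS).of_mem_Icc (htruthful hhS) ⟨(hL.2.1 l hl).le, (hH.2.1 h hh).le⟩⟩
  · obtain ⟨s, hs, hsR⟩ := Finset.not_subset.1 hex
    have hsn : s ∈ nbrs := (Finset.mem_sdiff.1 (Finset.mem_inter.1 hs).1).1
    exact ⟨s, Finset.mem_insert_of_mem (Finset.mem_sdiff.2 ⟨hsn, hsR⟩), htruthful hs⟩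

end Trim

section Average

variable {N D : ℕ} {Gc : Digraph (Fin N)} {A S : Finset (Fin N)} {η : ℝ} {i : Fin N}
  {val : Fin N → ℝ} {out : ℝ}

lemma TruthfulAverage.isWeightedMean (h : TruthfulAverage Gc D η i (val i) val out) (hη : 0 ≤ η)
    (hA : (inNbrs Gc i ∩ A).card ≤ D) (hS : D < ((inNbrs Gc i \ A) ∩ S).card) :
    IsWeightedMean (insert i (inNbrs Gc i \ A)) S η val out := by
  obtain ⟨Y, w, hY, hw, hw1, rfl⟩ := h
  obtain ⟨j₀, hj₀, hone⟩ := hY.exists_isWeightedMean_one hS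
  have hmean : ∀ j ∈ Y, IsWeightedMean (insert i (inNbrs Gc i \ A)) S
      ((Pi.single j₀ 1 : Fin N → ℝ) j) val (val j) := fun j hj => by
    obtain rfl | hne := eq_or_ne j j₀
    · rwa [Pi.single_eq_same]
    · rw [Pi.single_eq_of_ne hne]
      exact hY.isWeightedMean hA hj
  refine (IsWeightedMean.sum (fun j hj => hη.trans (hw j hj)) hw1 hmean).mono ?_
  simpa [Pi.single_apply, hj₀] using hw j₀ hj₀

lemma AdversaryAverage.isWeightedMean (h : AdversaryAverage Gc A η i val out)
    (hS : inNbrs Gc i \ A ⊆ S) : IsWeightedMean (insert i (inNbrs Gc i \ A)) S η val out := by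
  obtain ⟨w, hw0, hwT, hw1, hη, rfl⟩ := h
  refine ⟨w, ⟨hw0, hw1⟩, fun l hl => ?_, hη.trans ?_, rfl⟩
  · rw [Finset.mem_insert, not_or] at hl
    exact hwT l hl.2 hl.1
  · exact Finset.sum_le_sum_of_subset_of_nonneg hS fun l _ _ => hw0 l

end Average

/-! ### Levels -/

lemma exists_rank {V : Type*} [Fintype V] [DecidableEq V] {Q : Finset V → V → Prop} (S : Finset V)
    (hQ : ∀ T, S ⊆ T → T ≠ Finset.univ → ∃ j ∉ T, Q T j) :
    ∃ rank : V → ℕ, (∀ j, rank j ≤ Sᶜ.card) ∧ (∀ j, rank j = 0 ↔ j ∈ S) ∧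
      ∀ j ∉ S, Q {l | rank l < rank j} j := by
  induction h : Sᶜ.card generalizing S with
  | zero =>
    obtain rfl : S = Finset.univ := by rwa [Finset.card_eq_zero, Finset.compl_eq_empty_iff] at h
    exact ⟨0, by simp, by simp, by simp⟩
  | succ c ih =>
    have hS : S ≠ Finset.univ := by rintro rfl; simp at h
    obtain ⟨j₀, hj₀, hQj₀⟩ := hQ S subset_rfl hS
    have hcard : (insert j₀ S)ᶜ.card = c := by
      rw [Finset.compl_insert, Finset.card_erase_of_mem (Finset.mem_compl.2 hj₀), h,
        Nat.add_sub_cancel]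
    obtain ⟨rank, hle, hzero, hrank⟩ :=
      ih (insert j₀ S) (fun T hT => hQ T ((Finset.subset_insert _ _).trans hT)) hcard
    refine ⟨fun j => if j ∈ S then 0 else rank j + 1, fun j => ?_, by simp, fun j hj => ?_⟩
    · dsimp only
      split_ifs
      · exact Nat.zero_le _
      · exact Nat.succ_le_succ (hle j)
    obtain rfl | hne := eq_or_ne j j₀
    · have hj0 : rank j = 0 := (hzero j).2 (Finset.mem_insert_self _ _)
      convert hQj₀ using 1
      ext l
      by_cases hl : l ∈ S <;> simp [hl, hj, hj0]
    · have hjS : j ∉ insert j₀ S := by simp [hne, hj]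
      have hjpos : 0 < rank j := Nat.pos_of_ne_zero fun h0 => hjS ((hzero j).1 h0)
      convert hrank j hjS using 1
      ext l
      by_cases hl : l ∈ S
      · simp [hl, hj, (hzero l).2 (Finset.mem_insert_of_mem hl), hjpos]
      · simp [hl, hj]

section Levels

variable {N D : ℕ} {Gc Go : Digraph (Fin N)} {A : Finset (Fin N)} {m : Fin N}

lemma mem_outNbrs {G : Digraph (Fin N)} {i j : Fin N} : j ∈ outNbrs G i ↔ G.Adj i j := by
  simp [outNbrs]

lemma mem_inNbrs {G : Digraph (Fin N)} {i j : Fin N} : j ∈ inNbrs G i ↔ G.Adj j i := by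
  simp [inNbrs]

lemma InfoRobust.exists_observed_or_card_le {r : ℕ} (h : InfoRobust Gc Go r m) {S : Finset (Fin N)}
    (hS : S ≠ Finset.univ) : ∃ j ∉ S, Go.Adj m j ∨ r ≤ (inNbrs Gc j ∩ S).card := by
  by_cases hobs : outNbrs Go m ⊆ S
  · obtain ⟨j, hj, hcard⟩ := h S hobs hS
    exact ⟨j, hj, Or.inr hcard⟩
  · obtain ⟨j, hj, hjS⟩ := Finset.not_subset.1 hobs
    exact ⟨j, hjS, Or.inl (mem_outNbrs.1 hj)⟩

-- Adversaries cannot help in spreading information, so they count as informed from the start.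
lemma exists_truthful_rank (hlocal : IsLocalSet Gc D A) (hrobust : InfoRobust Gc Go (2 * D + 1) m) :
    ∃ rank : Fin N → ℕ, (∀ i, rank i ≤ (insert m A)ᶜ.card) ∧
      (∀ i, rank i = 0 ↔ i ∈ insert m A) ∧
      ∀ i ∉ insert m A, ¬ Go.Adj m i → D < {l ∈ inNbrs Gc i \ A | rank l < rank i}.card := by
  obtain ⟨rank, hle, hzero, hrank⟩ := exists_rank (insert m A)
    (Q := fun S j => Go.Adj m j ∨ 2 * D + 1 ≤ (inNbrs Gc j ∩ S).card)
    fun S _ hS => hrobust.exists_observed_or_card_le hS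
  refine ⟨rank, hle, hzero, fun i hi hobs => ?_⟩
  have hcard := (hrank i hi).resolve_left hobs
  have hA := hlocal i fun hiA => hi (Finset.mem_insert_of_mem hiA)
  have hsub : inNbrs Gc i ∩ ({l | rank l < rank i} : Finset (Fin N)) ⊆
      (inNbrs Gc i ∩ A) ∪ {l ∈ inNbrs Gc i \ A | rank l < rank i} := fun l hl => by
    simp only [Finset.mem_inter, Finset.mem_union, Finset.mem_sdiff, Finset.mem_filter,
      Finset.mem_univ, true_and] at hl ⊢
    tauto
  have := (Finset.card_le_card hsub).trans (Finset.card_union_le _ _)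
  lia

/-- The agents that are informed about `m` before `i` is: those of smaller level, and `m` itself,
whatever its level. -/
def informedBefore (lev : Fin N → ℕ) (m i : Fin N) : Finset (Fin N) :=
  {l | l = m ∨ lev l < lev i}

lemma mem_informedBefore {lev : Fin N → ℕ} {i l : Fin N} :
    l ∈ informedBefore lev m i ↔ l = m ∨ lev l < lev i := by
  simp [informedBefore]

/-- Levels along which information about `m` spreads among the truthful agents. Agents that observe
`m` are not restricted. -/
structure IsLeveling (Gc Go : Digraph (Fin N)) (A : Finset (Fin N)) (D : ℕ) (m : Fin N)
    (lev : Fin N → ℕ) : Prop where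
  lt_card_sub_one : ∀ i, lev i < N - 1
  truthful : ∀ i ∉ A, ¬ Go.Adj m i → D < ((inNbrs Gc i \ A) ∩ informedBefore lev m i).card
  adversary : ∀ i ∈ A, ¬ Go.Adj m i → Aᶜ ⊆ informedBefore lev m i

lemma exists_isLeveling (hN : 2 ≤ N) (hself : Go.Adj m m) (hlocal : IsLocalSet Gc D A)
    (hrobust : InfoRobust Gc Go (2 * D + 1) m) : ∃ lev, IsLeveling Gc Go A D m lev := by
  obtain ⟨rank, hle, hzero, hrank⟩ := exists_truthful_rank hlocal hrobust
  have hcard (s : Finset (Fin N)) : sᶜ.card = N - s.card := by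
    rw [Finset.card_compl, Fintype.card_fin]
  have hpos : ∀ l ∉ A, l ≠ m → 0 < rank l := fun l hl hlm =>
    Nat.pos_of_ne_zero fun h0 => by simpa [hl, hlm] using (hzero l).1 h0
  refine ⟨fun i => if i ∈ A then N - 2 else rank i - 1, fun i => ?_, fun i hi hobs => ?_,
    fun i hi hobs l hl => ?_⟩
  · have hle' := hle i
    have := Finset.card_pos.2 ⟨m, Finset.mem_insert_self m A⟩
    rw [hcard] at hle'
    grind
  · have him : i ≠ m := by rintro rfl; exact hobs hself
    refine (hrank i (by simp [hi, him]) hobs).trans_le (Finset.card_le_card fun l hl => ?_)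
    obtain ⟨hl, hlt⟩ := Finset.mem_filter.1 hl
    have hlA := (Finset.mem_sdiff.1 hl).2
    refine Finset.mem_inter.2 ⟨hl, mem_informedBefore.2 (or_iff_not_imp_left.2 fun hlm => ?_)⟩
    have := hpos l hlA hlm
    simp only [hi, hlA, if_false]
    lia
  · have hlA := Finset.mem_compl.1 hl
    refine mem_informedBefore.2 (or_iff_not_imp_left.2 fun hlm => ?_)
    have him : m ≠ i := by rintro rfl; exact hobs hself
    have htwo : 2 ≤ (insert m A).card := by
      rw [← Finset.card_pair him]
      exact Finset.card_le_card (Finset.insert_subset_insert m (Finset.singleton_subset_iff.2 hi))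
    have hle' := hle l
    have := hpos l hlA hlm
    rw [hcard] at hle'
    simp only [hi, hlA, if_true, if_false]
    lia

end Levels

/-! ### Products of substochastic matrices with levels -/

/-- A substochastic matrix in which every row has weight at most `1 - ε` on the indices of the same
or a higher level. It models averaging with the value `0`: the weight missing from a row is on an
exact value, and weight at least `ε` is on exact values or on indices of smaller level. -/
structure LevelSubstochastic {ι : Type*} [Fintype ι] (lev : ι → ℕ) (ε : ℝ) (B : Matrix ι ι ℝ) :
    Prop where
  nonneg : ∀ i l, 0 ≤ B i l
  row_sum : ∀ i, ∑ l, B i l ≤ 1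
  high_sum : ∀ i, ∑ l with lev i ≤ lev l, B i l ≤ 1 - ε

namespace LevelSubstochastic

variable {ι : Type*} [Fintype ι] {lev : ι → ℕ} {ε : ℝ}

section OneStep

variable {B : Matrix ι ι ℝ}

lemma mono {ε' : ℝ} (hB : LevelSubstochastic lev ε B) (hε : ε' ≤ ε) :
    LevelSubstochastic lev ε' B :=
  ⟨hB.nonneg, hB.row_sum, fun i => (hB.high_sum i).trans (sub_le_sub_left hε 1)⟩

lemma abs_mulVec_le (hB : LevelSubstochastic lev ε B) (u : ι → ℝ) (i : ι) :
    |(B.mulVec u) i| ≤ ∑ l, B i l * |u l| :=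
  (Finset.abs_sum_le_sum_abs _ _).trans_eq <| Finset.sum_congr rfl fun l _ => by
    rw [abs_mul, abs_of_nonneg (hB.nonneg i l)]

lemma norm_mulVec_le (hB : LevelSubstochastic lev ε B) (u : ι → ℝ) : ‖B.mulVec u‖ ≤ ‖u‖ := by
  refine (pi_norm_le_iff_of_nonneg (norm_nonneg u)).2 fun i => ?_
  calc |(B.mulVec u) i| ≤ ∑ l, B i l * |u l| := hB.abs_mulVec_le u i
    _ ≤ ∑ l, B i l * ‖u‖ := Finset.sum_le_sum fun l _ =>
        mul_le_mul_of_nonneg_left (norm_le_pi_norm u l) (hB.nonneg i l)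
    _ = (∑ l, B i l) * ‖u‖ := (Finset.sum_mul ..).symm
    _ ≤ ‖u‖ := mul_le_of_le_one_left (norm_nonneg u) (hB.row_sum i)

lemma abs_mulVec_le_of_level (hB : LevelSubstochastic lev ε B) {u : ι → ℝ} {M c : ℝ}
    (hu : ‖u‖ ≤ M) (hc : 0 ≤ c) (hc1 : c ≤ 1) {i : ι}
    (hlow : ∀ l, lev l < lev i → |u l| ≤ M * (1 - c)) :
    |(B.mulVec u) i| ≤ M * (1 - c * ε) := by
  have hM : 0 ≤ M := (norm_nonneg u).trans hu
  set high := ∑ l with lev i ≤ lev l, B i l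
  set low := ∑ l with ¬ lev i ≤ lev l, B i l
  have hsum : high + low ≤ 1 :=
    (Finset.sum_filter_add_sum_filter_not _ _ _).trans_le (hB.row_sum i)
  calc |(B.mulVec u) i| ≤ ∑ l, B i l * |u l| := hB.abs_mulVec_le u i
    _ = ∑ l with lev i ≤ lev l, B i l * |u l| + ∑ l with ¬ lev i ≤ lev l, B i l * |u l| :=
        (Finset.sum_filter_add_sum_filter_not _ _ _).symm
    _ ≤ ∑ l with lev i ≤ lev l, B i l * M + ∑ l with ¬ lev i ≤ lev l, B i l * (M * (1 - c)) := by
        gcongr with l _ l hl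
        · exact hB.nonneg i l
        · exact (norm_le_pi_norm u l).trans hu
        · exact hB.nonneg i l
        · exact hlow l (not_le.1 (Finset.mem_filter.1 hl).2)
    _ = high * M + low * (M * (1 - c)) := by rw [Finset.sum_mul, Finset.sum_mul]
    _ = M * ((high + low) * (1 - c) + c * high) := by ring
    _ ≤ M * (1 * (1 - c) + c * (1 - ε)) := by
        gcongr
        exact hB.high_sum i
    _ = M * (1 - c * ε) := by ring

end OneStep

section Sequence

variable {B : ℕ → Matrix ι ι ℝ} {u : ℕ → ι → ℝ}

lemma norm_antitone (hB : ∀ s, LevelSubstochastic lev ε (B s))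
    (hu : ∀ s, u (s + 1) = (B s).mulVec (u s)) : Antitone fun s => ‖u s‖ :=
  antitone_nat_of_succ_le fun s => by rw [hu]; exact (hB s).norm_mulVec_le (u s)

lemma abs_le_of_level_lt (hB : ∀ s, LevelSubstochastic lev ε (B s))
    (hu : ∀ s, u (s + 1) = (B s).mulVec (u s)) (hε : 0 ≤ ε) (hε1 : ε ≤ 1) {s : ℕ} {i : ι}
    (hi : lev i < s) : |u s i| ≤ ‖u 0‖ * (1 - ε ^ (lev i + 1)) := by
  induction s generalizing i with
  | zero => exact absurd hi (Nat.not_lt_zero _)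
  | succ s ih =>
    rw [hu, pow_succ]
    refine (hB s).abs_mulVec_le_of_level (norm_antitone hB hu s.zero_le) (pow_nonneg hε _)
      (pow_le_one₀ hε hε1) fun l hl => (ih (hl.trans_le (Nat.lt_succ_iff.1 hi))).trans ?_
    gcongr ?_ * (1 - ?_)
    exact pow_le_pow_of_le_one hε hε1 hl

lemma norm_le_of_level_lt (hB : ∀ s, LevelSubstochastic lev ε (B s))
    (hu : ∀ s, u (s + 1) = (B s).mulVec (u s)) (hε : 0 ≤ ε) (hε1 : ε ≤ 1) {n : ℕ}
    (hlev : ∀ i, lev i < n) : ‖u n‖ ≤ (1 - ε ^ n) * ‖u 0‖ := by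
  have hC : 0 ≤ 1 - ε ^ n := sub_nonneg.2 (pow_le_one₀ hε hε1)
  refine (pi_norm_le_iff_of_nonneg (by positivity)).2 fun i => ?_
  refine (abs_le_of_level_lt hB hu hε hε1 (hlev i)).trans ?_
  rw [mul_comm]
  gcongr ?_ * _
  exact sub_le_sub_left (pow_le_pow_of_le_one hε hε1 (hlev i)) 1

lemma norm_le_pow (hB : ∀ s, LevelSubstochastic lev ε (B s))
    (hu : ∀ s, u (s + 1) = (B s).mulVec (u s)) (hε : 0 ≤ ε) (hε1 : ε ≤ 1) {n : ℕ}
    (hlev : ∀ i, lev i < n) (s : ℕ) : ‖u s‖ ≤ (1 - ε ^ n) ^ (s / n) * ‖u 0‖ := by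
  have hC : 0 ≤ 1 - ε ^ n := sub_nonneg.2 (pow_le_one₀ hε hε1)
  have hmul (q : ℕ) : ‖u (n * q)‖ ≤ (1 - ε ^ n) ^ q * ‖u 0‖ := by
    induction q with
    | zero => simp
    | succ q ih =>
      have hn := norm_le_of_level_lt (B := fun s => B (n * q + s)) (u := fun s => u (n * q + s))
        (fun s => hB _) (fun s => hu _) hε hε1 hlev
      calc ‖u (n * q + n)‖ ≤ (1 - ε ^ n) * ‖u (n * q)‖ := hn
        _ ≤ (1 - ε ^ n) * ((1 - ε ^ n) ^ q * ‖u 0‖) := by gcongr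
        _ = (1 - ε ^ n) ^ (q + 1) * ‖u 0‖ := by ring
  exact (norm_antitone hB hu (Nat.mul_div_le s n)).trans (hmul _)

end Sequence

end LevelSubstochastic

/-! ### Energy of a decaying linear recursion -/

section Energy

variable {H V : Type*} [SeminormedAddCommGroup H] [NormedSpace ℝ H]
  [SeminormedAddCommGroup V] [NormedSpace ℝ V]

/-- The transition map of the recursion `z ↦ T k z` from time `k` to time `k + l`. -/
def transition (T : ℕ → V →ₗ[ℝ] V) : ℕ → ℕ → V →ₗ[ℝ] V
  | _, 0 => LinearMap.id
  | k, l + 1 => transition T (k + 1) l ∘ₗ T k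

lemma transition_succ (T : ℕ → V →ₗ[ℝ] V) (k l : ℕ) :
    transition T k (l + 1) = T (k + l) ∘ₗ transition T k l := by
  induction l generalizing k with
  | zero => rfl
  | succ l ih =>
    rw [transition, ih, transition, LinearMap.comp_assoc, Nat.add_right_comm, Nat.add_assoc]

/-- Exponential decay, at rate `ρ` for the squared norm, of all states and of the response to inputs
that enter through `U`. Inputs are measured by their own norm, so that the norm of `U` does not
enter the constant. -/
structure GeometricDecay (T : ℕ → V →ₗ[ℝ] V) (U : H →ₗ[ℝ] V) (K ρ : ℝ) : Prop where
  rate_nonneg : 0 ≤ ρ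
  rate_lt_one : ρ < 1
  one_le_const : 1 ≤ K
  state : ∀ k l z, ‖transition T k l z‖ ^ 2 ≤ K * ρ ^ l * ‖z‖ ^ 2
  input : ∀ k l w, ‖transition T k l (U w)‖ ^ 2 ≤ K * ρ ^ l * ‖w‖ ^ 2

/-- The energy of the unforced trajectory that starts in `z` at time `k`; it serves as a Lyapunov
function of the recursion. -/
noncomputable def energy (T : ℕ → V →ₗ[ℝ] V) (k : ℕ) (z : V) : ℝ :=
  ∑' l, ‖transition T k l z‖ ^ 2

lemma energy_nonneg (T : ℕ → V →ₗ[ℝ] V) (k : ℕ) (z : V) : 0 ≤ energy T k z :=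
  tsum_nonneg fun _ => sq_nonneg _

namespace GeometricDecay

variable {T : ℕ → V →ₗ[ℝ] V} {U : H →ₗ[ℝ] V} {K ρ : ℝ}

lemma one_le_div_one_sub (hT : GeometricDecay T U K ρ) : 1 ≤ K / (1 - ρ) := by
  rw [le_div_iff₀ (sub_pos.2 hT.rate_lt_one)]
  linarith [hT.rate_nonneg, hT.one_le_const]

lemma summable (hT : GeometricDecay T U K ρ) (k : ℕ) (z : V) :
    Summable fun l => ‖transition T k l z‖ ^ 2 :=
  .of_nonneg_of_le (fun _ => sq_nonneg _) (hT.state k · z)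
    (((summable_geometric_of_lt_one hT.rate_nonneg hT.rate_lt_one).mul_left K).mul_right _)

lemma energy_eq (hT : GeometricDecay T U K ρ) (k : ℕ) (z : V) :
    energy T k z = ‖z‖ ^ 2 + energy T (k + 1) (T k z) :=
  (hT.summable k z).tsum_eq_zero_add

lemma norm_mul_norm_le (hT : GeometricDecay T U K ρ) (k l : ℕ) (z : V) (w : H) :
    ‖transition T k l z‖ * ‖transition T k l (U w)‖ ≤ K * ρ ^ l * (‖z‖ * ‖w‖) := by
  have hK : 0 ≤ K * ρ ^ l :=
    mul_nonneg (zero_le_one.trans hT.one_le_const) (pow_nonneg hT.rate_nonneg l)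
  refine le_of_sq_le_sq ?_ (by positivity)
  calc (‖transition T k l z‖ * ‖transition T k l (U w)‖) ^ 2
      = ‖transition T k l z‖ ^ 2 * ‖transition T k l (U w)‖ ^ 2 := mul_pow ..
    _ ≤ (K * ρ ^ l * ‖z‖ ^ 2) * (K * ρ ^ l * ‖w‖ ^ 2) := by
        gcongr
        exacts [hT.state k l z, hT.input k l w]
    _ = (K * ρ ^ l * (‖z‖ * ‖w‖)) ^ 2 := by ring

lemma norm_transition_add_sq_le (hT : GeometricDecay T U K ρ) (k l : ℕ) (z : V) (w : H) :
    ‖transition T k l (z + U w)‖ ^ 2 ≤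
      ‖transition T k l z‖ ^ 2 + (2 * (‖z‖ * ‖w‖) + ‖w‖ ^ 2) * (K * ρ ^ l) := by
  have htri : ‖transition T k l (z + U w)‖ ^ 2 ≤
      (‖transition T k l z‖ + ‖transition T k l (U w)‖) ^ 2 := by
    rw [map_add]
    gcongr
    exact norm_add_le _ _
  linarith [hT.norm_mul_norm_le k l z w, hT.input k l w]

lemma energy_add_le (hT : GeometricDecay T U K ρ) (k : ℕ) (z : V) (w : H) :
    energy T (k + 1) (T k (z + U w)) ≤
      energy T k z - ‖z‖ ^ 2 + (2 * (‖z‖ * ‖w‖) + ‖w‖ ^ 2) * (K / (1 - ρ) - 1) := by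
  set c := 2 * (‖z‖ * ‖w‖) + ‖w‖ ^ 2
  have hgeom : HasSum (fun l => K * ρ ^ (l + 1)) (K / (1 - ρ) - K) := by
    have hρ : 1 - ρ ≠ 0 := (sub_pos.2 hT.rate_lt_one).ne'
    have hval : K / (1 - ρ) - K = K * ρ * (1 - ρ)⁻¹ := by
      field_simp
      ring
    simpa only [hval, pow_succ', mul_assoc] using
      (hasSum_geometric_of_lt_one hT.rate_nonneg hT.rate_lt_one).mul_left (K * ρ)
  calc energy T (k + 1) (T k (z + U w))
      ≤ ∑' l, (‖transition T (k + 1) l (T k z)‖ ^ 2 + c * (K * ρ ^ (l + 1))) :=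
        (hT.summable _ _).tsum_le_tsum (fun l => hT.norm_transition_add_sq_le k (l + 1) z w)
          ((hT.summable _ _).add (hgeom.summable.mul_left c))
    _ = energy T (k + 1) (T k z) + c * (K / (1 - ρ) - K) := by
        rw [(hT.summable _ _).tsum_add (hgeom.summable.mul_left c), (hgeom.mul_left c).tsum_eq,
          energy]
    _ ≤ energy T (k + 1) (T k z) + c * (K / (1 - ρ) - 1) := by
        gcongr
        exact hT.one_le_const
    _ = energy T k z - ‖z‖ ^ 2 + c * (K / (1 - ρ) - 1) := by rw [hT.energy_eq k z]; ring

end GeometricDecay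

end Energy

/-! ### Gradient play with a decaying error -/

section GradientPlay

open Matrix

open scoped MatrixOrder in
lemma exists_pos_mul_dotProduct_le_of_posDef {n : Type*} [Fintype n] [Nonempty n]
    {M : Matrix n n ℝ} (hM : M.PosDef) :
    ∃ r > 0, ∀ u : n → ℝ, r * (u ⬝ᵥ u) ≤ u ⬝ᵥ M *ᵥ u := by
  classical
  obtain ⟨r, hr, hrM⟩ := (CFC.exists_pos_algebraMap_le_iff (a := M) hM.isHermitian).2
    fun _ => hM.isStrictlyPositive.spectrum_pos
  refine ⟨r, hr, fun u => ?_⟩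
  have hnonneg := (Matrix.le_iff.1 hrM).dotProduct_mulVec_nonneg u
  rwa [star_trivial, Algebra.algebraMap_eq_smul_one, sub_mulVec, smul_mulVec, one_mulVec,
    dotProduct_sub, dotProduct_smul, smul_eq_mul, sub_nonneg] at hnonneg

lemma tendsto_zero_of_le_sub {W s : ℕ → ℝ} (hW : ∀ k, 0 ≤ W k) (hs : ∀ k, 0 ≤ s k)
    (hstep : ∀ k, W (k + 1) ≤ W k - s k) : Filter.Tendsto s Filter.atTop (nhds 0) := by
  have hsum (n : ℕ) : ∑ k ∈ Finset.range n, s k ≤ W 0 - W n := by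
    induction n with
    | zero => simp
    | succ n ih =>
      rw [Finset.sum_range_succ]
      linarith [hstep n]
  exact (summable_of_sum_range_le hs fun n =>
    (hsum n).trans (sub_le_self _ (hW n))).tendsto_atTop_zero

lemma dotProduct_matM_mulVec (μ L p α δ E : ℝ) :
    ![δ, E] ⬝ᵥ matM μ L p α *ᵥ ![δ, E] =
      (2 * α * μ - p * α ^ 2 * L ^ 2) * δ ^ 2 - 2 * (α * p * L * (1 + α * L)) * (δ * E) +
        (1 - 2 * α * (p - 1) * L - p * α ^ 2 * L ^ 2) * E ^ 2 := by
  simp only [matM, cons_mulVec, empty_mulVec, cons_dotProduct_cons,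
    dotProduct_of_isEmpty]
  ring

lemma pos_of_posDef_matM {μ L p α : ℝ} (hμ : 0 < μ) (hp : 0 ≤ p) (hM : (matM μ L p α).PosDef) :
    0 < α := by
  have hdiag : 0 < 2 * α * μ - p * α ^ 2 * L ^ 2 := hM.diag_pos (i := 0)
  have hpos : 0 < α * μ := by linarith [show 0 ≤ p * α ^ 2 * L ^ 2 by positivity]
  exact pos_of_mul_pos_left hpos hμ.le

variable {H V : Type*} [NormedAddCommGroup H] [InnerProductSpace ℝ H] [SeminormedAddCommGroup V]
  [NormedSpace ℝ V] {F : H → H} {x₀ : H} {T : ℕ → V →ₗ[ℝ] V} {U : H →ₗ[ℝ] V} {K ρ μ α : ℝ}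
  {L : NNReal}

lemma GeometricDecay.lyapunov_succ_le (hT : GeometricDecay T U K ρ) (hF : StronglyMonotone μ F)
    (hL : LipschitzWith L F) (hx₀ : F x₀ = 0) (hα : 0 ≤ α) {x g : H} {z : V}
    (hg : ‖g - F x‖ ≤ L * ‖z‖) (k : ℕ) :
    ‖x - α • g - x₀‖ ^ 2 + energy T (k + 1) (T k (z + α • U g)) ≤
      ‖x - x₀‖ ^ 2 + energy T k z -
        ![‖x - x₀‖, ‖z‖] ⬝ᵥ matM μ L (K / (1 - ρ)) α *ᵥ ![‖x - x₀‖, ‖z‖] := by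
  have hp := hT.one_le_div_one_sub
  have hdist := hF.norm_sub_smul_sub_sq_le hα hx₀ hg
  have henergy := hT.energy_add_le k z (α • g)
  rw [map_smul, norm_smul, Real.norm_of_nonneg hα] at henergy
  rw [dotProduct_matM_mulVec]
  set p := K / (1 - ρ)
  have hgle : ‖g‖ ≤ L * (‖x - x₀‖ + ‖z‖) := by
    have hFx : ‖F x‖ ≤ L * ‖x - x₀‖ := by simpa [hx₀] using hL.norm_sub_le x x₀
    linarith [norm_le_norm_sub_add g (F x)]
  have hsq : p * α ^ 2 * ‖g‖ ^ 2 ≤ p * α ^ 2 * (L * (‖x - x₀‖ + ‖z‖)) ^ 2 := by gcongr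
  have hcross : 2 * α * (p - 1) * ‖z‖ * ‖g‖ ≤
      2 * α * (p - 1) * ‖z‖ * (L * (‖x - x₀‖ + ‖z‖)) := by
    have := sub_nonneg.2 hp
    gcongr
  linarith

theorem GeometricDecay.tendsto_gradientPlay (hT : GeometricDecay T U K ρ)
    (hF : StronglyMonotone μ F) (hL : LipschitzWith L F) (hx₀ : F x₀ = 0) (hμ : 0 < μ)
    (hM : (matM μ L (K / (1 - ρ)) α).PosDef) {X g : ℕ → H} {e : ℕ → V}
    (hX : ∀ k, X (k + 1) = X k - α • g k) (he : ∀ k, e (k + 1) = T k (e k + α • U (g k)))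
    (hg : ∀ k, ‖g k - F (X k)‖ ≤ L * ‖e k‖) :
    Filter.Tendsto X Filter.atTop (nhds x₀) ∧
      Filter.Tendsto (fun k => ‖e k‖) Filter.atTop (nhds 0) := by
  obtain ⟨r, hr, hrM⟩ := exists_pos_mul_dotProduct_le_of_posDef hM
  have hα := pos_of_posDef_matM hμ (zero_le_one.trans hT.one_le_div_one_sub) hM
  have hdescent (k : ℕ) : ‖X (k + 1) - x₀‖ ^ 2 + energy T (k + 1) (e (k + 1)) ≤
      ‖X k - x₀‖ ^ 2 + energy T k (e k) - r * (‖X k - x₀‖ ^ 2 + ‖e k‖ ^ 2) := by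
    have hquad := hrM ![‖X k - x₀‖, ‖e k‖]
    simp only [cons_dotProduct_cons, dotProduct_of_isEmpty, add_zero, ← sq] at hquad
    rw [hX, he]
    exact (hT.lyapunov_succ_le hF hL hx₀ hα.le (hg k) k).trans (sub_le_sub_left hquad _)
  have hlim : Filter.Tendsto (fun k => ‖X k - x₀‖ ^ 2 + ‖e k‖ ^ 2) Filter.atTop (nhds 0) := by
    have hlim := tendsto_zero_of_le_sub
      (fun k => add_nonneg (sq_nonneg ‖X k - x₀‖) (energy_nonneg T k (e k)))
      (fun k => by positivity) hdescent
    simpa [hr.ne'] using hlim.const_mul r⁻¹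
  have hsqrt {s : ℕ → ℝ} (hs : ∀ k, 0 ≤ s k)
      (hle : ∀ k, s k ^ 2 ≤ ‖X k - x₀‖ ^ 2 + ‖e k‖ ^ 2) :
      Filter.Tendsto s Filter.atTop (nhds 0) :=
    squeeze_zero hs (fun k => Real.le_sqrt_of_sq_le (hle k)) (by simpa using hlim.sqrt)
  exact ⟨tendsto_iff_norm_sub_tendsto_zero.2 <|
      hsqrt (fun _ => norm_nonneg _) fun _ => le_add_of_nonneg_right (sq_nonneg _),
    hsqrt (fun _ => norm_nonneg _) fun _ => le_add_of_nonneg_left (sq_nonneg _)⟩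

end GradientPlay

/-! ### Decay of componentwise mixing -/

section Mixing

variable {ι κ : Type*} [Fintype κ]

/-- Apply to each component `p` of a family of values, indexed by components and agents, the matrix
`B p` acting on the agents. -/
def mixing (B : ι → Matrix κ κ ℝ) :
    EuclideanSpace ℝ (ι × κ) →ₗ[ℝ] EuclideanSpace ℝ (ι × κ) where
  toFun z := WithLp.toLp 2 fun p => (B p.1).mulVec (fun l => z (p.1, l)) p.2
  map_add' z z' := by
    ext p
    exact congrFun (Matrix.mulVec_add (B p.1) (fun l => z (p.1, l)) fun l => z' (p.1, l)) p.2
  map_smul' c z := by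
    ext p
    exact congrFun (Matrix.mulVec_smul (B p.1) c fun l => z (p.1, l)) p.2

/-- Give every agent the same value of each component. -/
def replicate : EuclideanSpace ℝ ι →ₗ[ℝ] EuclideanSpace ℝ (ι × κ) where
  toFun w := WithLp.toLp 2 fun p => w p.1
  map_add' _ _ := rfl
  map_smul' _ _ := rfl

variable [Fintype ι]

lemma sum_norm_slice_sq_le (z : EuclideanSpace ℝ (ι × κ)) :
    ∑ p, ‖fun i => z (p, i)‖ ^ 2 ≤ ‖z‖ ^ 2 := by
  rw [EuclideanSpace.norm_sq_eq, Fintype.sum_prod_type]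
  refine Finset.sum_le_sum fun p _ => ?_
  set slice : EuclideanSpace ℝ κ := WithLp.toLp 2 fun i => z (p, i)
  calc ‖fun i => z (p, i)‖ ^ 2 ≤ ‖slice‖ ^ 2 := by
        gcongr
        exact (pi_norm_le_iff_of_nonneg (norm_nonneg slice)).2 (PiLp.norm_apply_le slice)
    _ = ∑ i, ‖z (p, i)‖ ^ 2 := EuclideanSpace.norm_sq_eq slice

lemma norm_sq_le_card_mul_sum_norm_slice_sq (z : EuclideanSpace ℝ (ι × κ)) :
    ‖z‖ ^ 2 ≤ Fintype.card κ * ∑ p, ‖fun i => z (p, i)‖ ^ 2 := by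
  rw [EuclideanSpace.norm_sq_eq, Fintype.sum_prod_type, Finset.mul_sum]
  refine Finset.sum_le_sum fun p _ => ?_
  rw [← nsmul_eq_mul]
  refine Finset.sum_le_card_nsmul _ _ _ fun i _ => ?_
  gcongr
  exact norm_le_pi_norm (fun i => z (p, i)) i

-- Rounding `l / n` down costs a factor of at most `C⁻²`, which is at most `4`.
lemma sq_pow_div_le {C : ℝ} (hC : 1 / 2 ≤ C) (hC1 : C ≤ 1) {n : ℕ} (hn : 0 < n) (l : ℕ) :
    (C ^ (l / n)) ^ 2 ≤ 4 * (C ^ (2 / n : ℝ)) ^ l := by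
  have hC0 : 0 < C := by linarith
  have hexp : 2 / (n : ℝ) * l ≤ (2 * (l / n + 1) : ℕ) := by
    have hl : (l : ℝ) ≤ n * (l / n + 1 : ℕ) := mod_cast (Nat.lt_mul_div_succ l hn).le
    rw [div_mul_eq_mul_div, div_le_iff₀ (by positivity)]
    push_cast at hl ⊢
    linarith
  have hrate : C ^ (2 * (l / n + 1)) ≤ (C ^ (2 / n : ℝ)) ^ l := by
    rw [← Real.rpow_mul_natCast hC0.le, ← Real.rpow_natCast]
    exact Real.rpow_le_rpow_of_exponent_ge hC0 hC1 hexp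
  calc (C ^ (l / n)) ^ 2 ≤ (2 * C) ^ 2 * (C ^ (l / n)) ^ 2 :=
        le_mul_of_one_le_left (sq_nonneg _) (one_le_pow₀ (by linarith))
    _ = 4 * C ^ (2 * (l / n + 1)) := by ring
    _ ≤ 4 * (C ^ (2 / n : ℝ)) ^ l := by gcongr

variable {B : ℕ → ι → Matrix κ κ ℝ} {lev : ι → κ → ℕ} {ε : ℝ} {n : ℕ}

lemma norm_transition_mixing_sq_le (hB : ∀ k p, LevelSubstochastic (lev p) ε (B k p))
    (hlev : ∀ p i, lev p i < n) (hn : 0 < n) (hε : 0 ≤ ε) (hε2 : ε ≤ 1 / 2) (k l : ℕ)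
    (z : EuclideanSpace ℝ (ι × κ)) :
    ‖transition (fun k => mixing (B k)) k l z‖ ^ 2 ≤
      4 * Fintype.card κ * ((1 - ε ^ n) ^ (2 / n : ℝ)) ^ l * ∑ p, ‖fun i => z (p, i)‖ ^ 2 := by
  set ρ := (1 - ε ^ n) ^ (2 / n : ℝ)
  have hεn : ε ^ n ≤ 1 / 2 := (pow_le_of_le_one hε (by linarith) hn.ne').trans hε2
  have hdecay := sq_pow_div_le (C := 1 - ε ^ n) (by linarith) (by linarith [pow_nonneg hε n]) hn l
  have hslice (p : ι) : ‖fun i => transition (fun k => mixing (B k)) k l z (p, i)‖ ^ 2 ≤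
      4 * ρ ^ l * ‖fun i => z (p, i)‖ ^ 2 := by
    have hpow := LevelSubstochastic.norm_le_pow (fun s => hB (k + s) p)
      (u := fun s i => transition (fun k => mixing (B k)) k s z (p, i))
      (fun s => by rw [transition_succ]; rfl)
      hε (by linarith) (hlev p) l
    calc ‖fun i => transition (fun k => mixing (B k)) k l z (p, i)‖ ^ 2
        ≤ ((1 - ε ^ n) ^ (l / n) * ‖fun i => z (p, i)‖) ^ 2 := by gcongr; exact hpow
      _ = ((1 - ε ^ n) ^ (l / n)) ^ 2 * ‖fun i => z (p, i)‖ ^ 2 := mul_pow ..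
      _ ≤ 4 * ρ ^ l * ‖fun i => z (p, i)‖ ^ 2 := by gcongr
  calc ‖transition (fun k => mixing (B k)) k l z‖ ^ 2
      ≤ Fintype.card κ * ∑ p, ‖fun i => transition (fun k => mixing (B k)) k l z (p, i)‖ ^ 2 :=
        norm_sq_le_card_mul_sum_norm_slice_sq _
    _ ≤ Fintype.card κ * ∑ p, 4 * ρ ^ l * ‖fun i => z (p, i)‖ ^ 2 := by
        gcongr with p
        exact hslice p
    _ = 4 * Fintype.card κ * ρ ^ l * ∑ p, ‖fun i => z (p, i)‖ ^ 2 := by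
        rw [← Finset.mul_sum]
        ring

lemma geometricDecay_mixing [Nonempty κ] (hB : ∀ k p, LevelSubstochastic (lev p) ε (B k p))
    (hlev : ∀ p i, lev p i < n) (hn : 0 < n) (hε : 0 < ε) (hε2 : ε ≤ 1 / 2) :
    GeometricDecay (fun k => mixing (B k)) replicate (4 * Fintype.card κ)
      ((1 - ε ^ n) ^ (2 / n : ℝ)) := by
  have hC0 : 0 ≤ 1 - ε ^ n := sub_nonneg.2 (pow_le_one₀ hε.le (by linarith))
  have hC1 : 1 - ε ^ n < 1 := sub_lt_self 1 (pow_pos hε n)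
  have hcard : (1 : ℝ) ≤ Fintype.card κ := mod_cast Fintype.card_pos
  refine ⟨Real.rpow_nonneg hC0 _, Real.rpow_lt_one hC0 hC1 (by positivity), by linarith,
    fun k l z => ?_, fun k l w => ?_⟩
  · refine (norm_transition_mixing_sq_le hB hlev hn hε.le hε2 k l z).trans ?_
    gcongr
    exact sum_norm_slice_sq_le z
  · refine (norm_transition_mixing_sq_le hB hlev hn hε.le hε2 k l _).trans ?_
    rw [EuclideanSpace.norm_sq_eq]
    gcongr with p
    exact pi_norm_const_le (w p)

end Mixing

/-! ### Executions of the algorithm -/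

section Execution

variable {N : ℕ} {d : Fin N → ℕ}

/-- The profile assembled from the own blocks of the agents. For the estimates `x k` it is the
profile that is played, for the pseudo-gradients at the `v k i` it is the search direction. -/
def ownBlocks (z : Fin N → Profile d) : Profile d :=
  WithLp.toLp 2 fun p => z p.1 p

/-- The errors of the estimates `z i` of the profile `X`, indexed by components and agents. -/
def estError (X : Profile d) (z : Fin N → Profile d) :
    EuclideanSpace ℝ (((m : Fin N) × Fin (d m)) × Fin N) :=
  WithLp.toLp 2 fun p => z p.2 p.1 - X p.1

lemma norm_estError_sq (X : Profile d) (z : Fin N → Profile d) :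
    ‖estError X z‖ ^ 2 = ∑ i, ‖z i - X‖ ^ 2 := by
  simp only [EuclideanSpace.norm_sq_eq, Fintype.sum_prod_type_right]
  rfl

lemma norm_sub_le_norm_estError (X : Profile d) (z : Fin N → Profile d) (i : Fin N) :
    ‖z i - X‖ ≤ ‖estError X z‖ := by
  refine le_of_sq_le_sq ?_ (norm_nonneg _)
  rw [norm_estError_sq]
  exact Finset.single_le_sum (f := fun i => ‖z i - X‖ ^ 2) (fun _ _ => sq_nonneg _)
    (Finset.mem_univ i)

lemma norm_ownBlocks_sub_le (X : Profile d) (z : Fin N → Profile d) :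
    ‖ownBlocks z - X‖ ≤ ‖estError X z‖ := by
  refine le_of_sq_le_sq ?_ (norm_nonneg _)
  rw [EuclideanSpace.norm_sq_eq, EuclideanSpace.norm_sq_eq, Fintype.sum_prod_type]
  exact Finset.sum_le_sum fun p _ => Finset.single_le_sum
    (f := fun i => ‖estError X z (p, i)‖ ^ 2) (fun _ _ => sq_nonneg _) (Finset.mem_univ p.1)

lemma norm_estError_comp_le {F : Profile d → Profile d} {L : NNReal} (hF : LipschitzWith L F)
    (X : Profile d) (z : Fin N → Profile d) :
    ‖estError (F X) fun i => F (z i)‖ ≤ L * ‖estError X z‖ := by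
  refine le_of_sq_le_sq ?_ (by positivity)
  rw [mul_pow, norm_estError_sq, norm_estError_sq, Finset.mul_sum]
  refine Finset.sum_le_sum fun i _ => ?_
  rw [← mul_pow]
  gcongr
  exact hF.norm_sub_le (z i) X

lemma IsWeightedMean.exists_row {lev : Fin N → ℕ} {m i : Fin N} {T : Finset (Fin N)} {η : ℝ}
    {f : Fin N → ℝ} {x : ℝ} (h : IsWeightedMean T (informedBefore lev m i) η f x) :
    ∃ b : Fin N → ℝ, (∀ l, 0 ≤ b l) ∧ ∑ l, b l ≤ 1 ∧ ∑ l with lev i ≤ lev l, b l ≤ 1 - η ∧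
      b m = 0 ∧ x - f m = ∑ l, b l * (f l - f m) := by
  obtain ⟨a, ⟨ha0, ha1⟩, -, haη, rfl⟩ := h
  set b : Fin N → ℝ := fun l => if l = m then 0 else a l with hb
  have hba (l : Fin N) : 0 ≤ b l ∧ b l ≤ a l := by grind
  refine ⟨b, fun l => (hba l).1, (Finset.sum_le_sum fun l _ => (hba l).2).trans_eq ha1, ?_,
    if_pos rfl, ?_⟩
  · have hdisjoint (l : Fin N) : (if lev i ≤ lev l then b l else 0) +
        (if l ∈ informedBefore lev m i then a l else 0) ≤ a l := by
      have hmem := mem_informedBefore (lev := lev) (m := m) (i := i) (l := l)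
      grind
    have hsum := Finset.sum_le_sum fun l (_ : l ∈ Finset.univ) => hdisjoint l
    rw [Finset.sum_add_distrib, ← Finset.sum_filter, ← Finset.sum_filter,
      Finset.filter_univ_mem, ha1] at hsum
    linarith
  · calc ∑ l, a l * f l - f m = ∑ l, a l * (f l - f m) := by
          simp only [mul_sub, Finset.sum_sub_distrib, ← Finset.sum_mul, ha1, one_mul]
      _ = ∑ l, b l * (f l - f m) := Finset.sum_congr rfl fun l _ => by
          by_cases hl : l = m <;> simp [hb, hl]

lemma pBar_eq {η : ℝ} (hN : 1 ≤ N) : pBar N η =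
    4 * Fintype.card (Fin N) / (1 - (1 - (η / 2) ^ (N - 1)) ^ (2 / (N - 1 : ℕ) : ℝ)) := by
  rw [Fintype.card_fin, Nat.cast_pred hN]
  rfl

variable {J : Fin N → Profile d → ℝ} {Gc Go : Digraph (Fin N)}
  {A : Finset (Fin N)} {D : ℕ} {η α : ℝ} {x v : ℕ → Fin N → Profile d}
  {y : ℕ → Fin N → Fin N → Profile d}

namespace IsExecution

lemma next_of_ne (h : IsExecution J Gc Go A D η α x v y) (k : ℕ) {i : Fin N}
    {p : (m : Fin N) × Fin (d m)} (hp : p.1 ≠ i) : x (k + 1) i p = v k i p := by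
  simp [h.gradient_step, setBlock_apply_of_ne _ _ hp]

lemma ownBlocks_succ (h : IsExecution J Gc Go A D η α x v y) (hself : ∀ i, Go.Adj i i) {k : ℕ}
    (hk : k ≠ 0) :
    ownBlocks (x (k + 1)) = ownBlocks (x k) - α • ownBlocks fun i => pseudoGrad J (v k i) := by
  ext ⟨m, q⟩
  simp [ownBlocks, h.gradient_step, setBlock_apply_self, h.observed k hk m m q (hself m),
    pseudoGrad]

lemma exists_isWeightedMean (h : IsExecution J Gc Go A D η α x v y) (hlocal : IsLocalSet Gc D A)
    (hη : 0 ≤ η) (hη1 : η ≤ 1) {m : Fin N} {lev : Fin N → ℕ}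
    (hlev : IsLeveling Gc Go A D m lev) {k : ℕ} (hk : k ≠ 0) (q : Fin (d m)) (i : Fin N) :
    ∃ T, IsWeightedMean T (informedBefore lev m i) η (fun l => x k l ⟨m, q⟩) (v k i ⟨m, q⟩) := by
  by_cases hobs : Go.Adj m i
  · rw [h.observed k hk i m q hobs]
    have hexact : IsWeightedMean {m} (informedBefore lev m i) 1 (fun l => x k l ⟨m, q⟩)
        (x k m ⟨m, q⟩) :=
      isWeightedMean_one_of_mem (Finset.mem_singleton_self m) (mem_informedBefore.2 (Or.inl rfl))
    exact ⟨{m}, hexact.mono hη1⟩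
  refine ⟨insert i (inNbrs Gc i \ A), IsWeightedMean.congr (f := fun j => y k i j ⟨m, q⟩) ?_
    fun l hl => ?_⟩
  · by_cases hi : i ∈ A
    · refine (h.adversary_average k hk i hi m q hobs).isWeightedMean fun l hl => ?_
      exact hlev.adversary i hi hobs (Finset.mem_compl.2 (Finset.mem_sdiff.1 hl).2)
    · have hmean := h.truthful_average k hk i hi m q hobs
      rw [← h.self_message] at hmean
      exact hmean.isWeightedMean hη (hlocal i hi) (hlev.truthful i hi hobs)
  · obtain rfl | hl := Finset.mem_insert.1 hl
    · rw [h.self_message]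
    · obtain ⟨hadj, hlA⟩ := Finset.mem_sdiff.1 hl
      rw [h.truthful_message k l hlA i (mem_inNbrs.1 hadj)]

lemma exists_matrix (h : IsExecution J Gc Go A D η α x v y) (hlocal : IsLocalSet Gc D A)
    (hη : 0 ≤ η) (hη1 : η ≤ 1) {m : Fin N} {lev : Fin N → ℕ}
    (hlev : IsLeveling Gc Go A D m lev) {k : ℕ} (hk : k ≠ 0) (q : Fin (d m)) :
    ∃ B : Matrix (Fin N) (Fin N) ℝ, LevelSubstochastic lev η B ∧ (∀ i, B i m = 0) ∧
      ∀ i, v k i ⟨m, q⟩ - x k m ⟨m, q⟩ =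
        ∑ l, B i l * (x k l ⟨m, q⟩ - x k m ⟨m, q⟩) := by
  choose T hT using h.exists_isWeightedMean hlocal hη hη1 hlev hk q
  choose B hB0 hB1 hBη hBm hB using fun i => (hT i).exists_row
  exact ⟨B, ⟨hB0, hB1, hBη⟩, hBm, hB⟩

lemma exists_mixing (h : IsExecution J Gc Go A D η α x v y) (hself : ∀ i, Go.Adj i i)
    (hlocal : IsLocalSet Gc D A) (hη : 0 ≤ η) (hη1 : η ≤ 1) {lev : Fin N → Fin N → ℕ}
    (hlev : ∀ m, IsLeveling Gc Go A D m (lev m)) {k : ℕ} (hk : k ≠ 0) :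
    ∃ B : (m : Fin N) × Fin (d m) → Matrix (Fin N) (Fin N) ℝ,
      (∀ p, LevelSubstochastic (lev p.1) η (B p)) ∧
      estError (ownBlocks (x (k + 1))) (v (k + 1)) =
        mixing B (estError (ownBlocks (x k)) (v k) +
          α • replicate (ownBlocks fun i => pseudoGrad J (v k i))) := by
  choose B hB hBm hv using fun p : (m : Fin N) × Fin (d m) =>
    h.exists_matrix hlocal hη hη1 (hlev p.1) k.succ_ne_zero p.2
  refine ⟨B, hB, ?_⟩
  ext ⟨p, i⟩
  refine (hv p i).trans (Finset.sum_congr rfl fun l _ => ?_)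
  change B p i l * (x (k + 1) l p - ownBlocks (x (k + 1)) p) =
    B p i l * (v k l p - ownBlocks (x k) p + α * ownBlocks (fun i => pseudoGrad J (v k i)) p)
  obtain rfl | hl := eq_or_ne l p.1
  · rw [hBm, zero_mul, zero_mul]
  · rw [h.ownBlocks_succ hself hk, h.next_of_ne k hl.symm, PiLp.sub_apply, PiLp.smul_apply,
      smul_eq_mul]
    ring

lemma tendsto_of_estError (h : IsExecution J Gc Go A D η α x v y) {xs : Profile d}
    (hX : Filter.Tendsto (fun k => ownBlocks (x (k + 1))) Filter.atTop (nhds xs))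
    (hv : Filter.Tendsto (fun k => ‖estError (ownBlocks (x (k + 1))) (v (k + 1))‖)
      Filter.atTop (nhds 0)) :
    Filter.Tendsto x Filter.atTop (nhds fun _ => xs) := by
  have hXp (p : (m : Fin N) × Fin (d m)) :
      Filter.Tendsto (fun k => ownBlocks (x (k + 2)) p) Filter.atTop (nhds (xs p)) :=
    ((PiLp.continuous_apply 2 _ p).tendsto xs).comp
      ((Filter.tendsto_add_atTop_iff_nat (f := fun k => ownBlocks (x (k + 1))) 1).2 hX)
  have hvi (i : Fin N) : Filter.Tendsto (fun k => v (k + 1) i) Filter.atTop (nhds xs) := by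
    have hsub := squeeze_zero_norm (fun k => norm_sub_le_norm_estError _ (v (k + 1)) i) hv
    simpa only [sub_add_cancel, zero_add] using hsub.add hX
  refine tendsto_pi_nhds.2 fun i => (Filter.tendsto_add_atTop_iff_nat 2).1 ?_
  refine (PiLp.homeomorph 2 _).isInducing.tendsto_nhds_iff.2 (tendsto_pi_nhds.2 fun p => ?_)
  obtain rfl | hp := eq_or_ne p.1 i
  · exact hXp p
  · exact (((PiLp.continuous_apply 2 _ p).tendsto xs).comp (hvi i)).congr fun k =>
      (h.next_of_ne (k + 1) hp).symm

theorem tendsto (h : IsExecution J Gc Go A D η α x v y) {μ : ℝ} {L : NNReal} {xs : Profile d}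
    (hF : StronglyMonotone μ (pseudoGrad J)) (hL : LipschitzWith L (pseudoGrad J)) (hμ : 0 < μ)
    (hxs : pseudoGrad J xs = 0) (hN : 2 ≤ N) (hself : ∀ i, Go.Adj i i) (hlocal : IsLocalSet Gc D A)
    (hrobust : ∀ m, InfoRobust Gc Go (2 * D + 1) m) (hη : 0 < η) (hη1 : η ≤ 1)
    (hM : (matM μ L (pBar N η) α).PosDef) : Filter.Tendsto x Filter.atTop (nhds fun _ => xs) := by
  have : Nonempty (Fin N) := ⟨⟨0, by lia⟩⟩
  choose lev hlev using fun m => exists_isLeveling hN (hself m) hlocal (hrobust m)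
  choose B hB hrec using fun k : ℕ =>
    h.exists_mixing hself hlocal hη.le hη1 hlev k.succ_ne_zero
  have hdecay := geometricDecay_mixing (B := B)
    (fun k p => (hB k p).mono (half_le_self hη.le)) (fun p => (hlev p.1).lt_card_sub_one)
    (by lia) (half_pos hη) (by linarith)
  rw [pBar_eq (one_le_two.trans hN)] at hM
  obtain ⟨hX, he⟩ := hdecay.tendsto_gradientPlay hF hL hxs hμ hM
    (X := fun k => ownBlocks (x (k + 1)))
    (g := fun k => ownBlocks fun i => pseudoGrad J (v (k + 1) i))
    (fun k => h.ownBlocks_succ hself k.succ_ne_zero) hrec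
    fun k => (norm_ownBlocks_sub_le _ _).trans (norm_estError_comp_le hL _ _)
  exact h.tendsto_of_estError hX he

end IsExecution

end Execution

end RobustNE

theorem theorem1_general {N : ℕ} (hN : 2 ≤ N) (d : Fin N → ℕ)
    (J : Fin N → RobustNE.Profile d → ℝ) (μ : ℝ) (L : NNReal)
    (hdiff : ∀ i x, Differentiable ℝ fun t : RobustNE.Action d i => J i (RobustNE.setBlock x i t))
    (hμ : 0 < μ) (hmono : RobustNE.StronglyMonotone μ (RobustNE.pseudoGrad J))
    (hlip : LipschitzWith L (RobustNE.pseudoGrad J))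
    (Gc Go : Digraph (Fin N)) (hself : ∀ i, Go.Adj i i)
    (A : Finset (Fin N)) (D : ℕ)
    (hlocal : RobustNE.IsLocalSet Gc D A)
    (hrobust : ∀ m, RobustNE.InfoRobust Gc Go (2 * D + 1) m)
    (η : ℝ) (hη : 0 < η) (hη1 : η ≤ 1) (α : ℝ)
    (hM : (RobustNE.matM μ (L : ℝ) (RobustNE.pBar N η) α).PosDef) :
    ∃ xs : RobustNE.Profile d, RobustNE.IsNash J xs ∧
      (∀ z, RobustNE.IsNash J z → z = xs) ∧
      ∀ (x v : ℕ → Fin N → RobustNE.Profile d)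
        (y : ℕ → Fin N → Fin N → RobustNE.Profile d),
        RobustNE.IsExecution J Gc Go A D η α x v y →
        Filter.Tendsto x Filter.atTop (nhds (fun _ => xs)) := by
  have hnash {z : RobustNE.Profile d} : RobustNE.IsNash J z ↔ RobustNE.pseudoGrad J z = 0 :=
    RobustNE.isNash_iff_pseudoGrad_eq_zero hdiff (hmono.inner_nonneg hμ.le)
  obtain ⟨xs, hxs, huniq⟩ := hmono.existsUnique_eq_zero hμ hlip
  exact ⟨xs, hnash.2 hxs, fun z hz => huniq z (hnash.1 hz), fun x v y hex =>
    hex.tendsto hmono hlip hμ hxs hN hself hlocal hrobust hη hη1 hM⟩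

theorem theorem1 {N : ℕ} (hN : 2 ≤ N) (d : Fin N → ℕ)
    (J : Fin N → RobustNE.Profile d → ℝ) (μ : ℝ) (L : NNReal)
    (hJ : RobustNE.RegularGame J μ L)
    (Gc Go : Digraph (Fin N)) (hself : ∀ i, Go.Adj i i)
    (A : Finset (Fin N)) (D : ℕ)
    (hlocal : RobustNE.IsLocalSet Gc D A)
    (hdeg : ∀ i ∉ A, 2 * D + 1 ≤ (RobustNE.inNbrs Gc i).card)
    (hrobust : ∀ m, RobustNE.InfoRobust Gc Go (2 * D + 1) m)
    (η : ℝ) (hη : 0 < η) (hη1 : η ≤ 1) (α : ℝ)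
    (hM : (RobustNE.matM μ (L : ℝ) (RobustNE.pBar N η) α).PosDef) :
    ∃ xs : RobustNE.Profile d, RobustNE.IsNash J xs ∧
      (∀ z, RobustNE.IsNash J z → z = xs) ∧
      ∀ (x v : ℕ → Fin N → RobustNE.Profile d)
        (y : ℕ → Fin N → Fin N → RobustNE.Profile d),
        RobustNE.IsExecution J Gc Go A D η α x v y →
        Filter.Tendsto x Filter.atTop (nhds (fun _ => xs)) := by
  exact theorem1_general hN d J μ L (fun i x => (hJ.contDiff i x).differentiable one_ne_zero)
    hJ.mu_pos hJ.stronglyMonotone hJ.lipschitz Gc Go hself A D hlocal hrobust η hη hη1 α hM
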